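/- **Setting.** Let $n\ge 2$, $p\ge 1$, let $\Sigma\in\mathbb R^{p\times p}$ be a known positive definite matrix, and let $X\sim\mathcal{MN}_{n\times p}(\mu,I_n,\Sigma)$, i.e. the rows of $X$ are independent and row $i$ has law $\mathcal N_p(\mu_i,\Sigma)$. *Randomized agglomerative clustering.* Let $d(M;x)\in\mathbb R$ be the dissimilarity (any linkage, measurable in the data matrix $x$) of the two clusters of a candidate merge $M=\{C,C'\}$, and let $\tau>0$. Start from the clustering $\mathcal C^{(1)}=\{\{1\},\dots,\{n\}\}$. At step $s$, let $\mathcal M^{(s)}$ be the set of all unordered pairs of distinct clusters of the current clustering $\mathcal C^{(s)}$. Given $X=x$ and the previous merges, the merge $M^{(s)}\in\mathcal M^{(s)}$ is drawn at random with $$p^{(s)}(M;x)=\frac{\exp\left(-d(M;x)/\tau^{(s)}(x)\right)}{\sum_{M'\in\mathcal M^{(s)}}\exp\left(-d(M';x)/\tau^{(s)}(x)\right)},\qquad \tau^{(s)}(x)=\frac{\tau}{|\mathcal M^{(s)}|}\sum_{M'\in\mathcal M^{(s)}}d(M';x)$$ (all candidates being equally likely if $\tau^{(s)}(x)=0$),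 and then the two clusters of $M^{(s)}$ are replaced by their union, which gives $\mathcal C^{(s+1)}$. *Observed merges and statistics.* Fix $t\ge 1$ and a possible sequence of merges $M_o^{(1)},\dots,M_o^{(t)}$ (each $M_o^{(s)}$ is a pair of distinct clusters of the clustering obtained from $M_o^{(1)},\dots,M_o^{(s-1)}$), and let $M_o^{(t)}=\{C_1,C_2\}$. Let $\nu\in\mathbb R^n$ have the entries $\nu_i=\mathbf 1\{i\in C_1\}/|C_1|-\mathbf 1\{i\in C_2\}/|C_2|$, and put $$U=\|\Sigma^{-1/2}X^{T}\nu\|_2,\qquad \xi=\mathrm{dir}(\Sigma^{-1/2}X^{T}\nu)^{T},\qquad \pi=\Big(I_n-\frac{\nu\nu^{T}}{\|\nu\|_2^2}\Big)X,\qquad \mathcal A=(\xi,\pi),$$ where $\mathrm{dir}(v)=v/\|v\|_2$ (and $\mathrm{dir}(0)=0$). For a value $a=(\xi_o,\pi_o)$ of $\mathcal A$ and $u\in\mathbb R$ let $X(u;a)=u\,\frac{\nu}{\|\nu\|_2^2}\,\xi_o\,\Sigma^{1/2}+\pi_o$. Let $\ell_{\|\nu\|_2\chi_p}$ be the density of $\|\nu\|_2$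 times a $\chi_p$ random variable. For $s\le t$, let $p^{(s)}(M_o^{(s)};X(u;a))$ be the above probability that step $s$ makes the merge $M_o^{(s)}$ from the clustering obtained from $M_o^{(1)},\dots,M_o^{(s-1)}$, at the data matrix $X(u;a)$. **Theorem.** Assume the null hypothesis $\bar\mu_{C_1}=\bar\mu_{C_2}$, where $\bar\mu_C=\frac1{|C|}\sum_{i\in C}\mu_i$. Then the event $E=\{M^{(1)}=M_o^{(1)},\dots,M^{(t)}=M_o^{(t)}\}$ has positive probability, and for almost every value $a$ of $\mathcal A$ (with respect to the law of $\mathcal A$ given $E$) the (regular) conditional distribution of $U$ given $E$ and $\mathcal A=a$ has the cumulative distribution function $$\mathbb F(u)=\frac{\displaystyle\int_0^{u}\ell_{\|\nu\|_2\chi_p}(u')\prod_{s=1}^{t}p^{(s)}\big(M_o^{(s)};X(u';a)\big)\,du'}{\displaystyle\int_0^{\infty}\ell_{\|\nu\|_2\chi_p}(u')\prod_{s=1}^{t}p^{(s)}\big(M_o^{(s)};X(u';a)\big)\,du'}\qquad(u\ge 0),$$ and $\mathbb F(u)=0$ for $u<0$, where the integrand is integrable on $(0,\infty)$ and the denominator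 is positive. -/

import Mathlib

open MeasureTheory ProbabilityTheory Matrix Set
open scoped MatrixOrder

noncomputable section

namespace RandClust

/-- Data matrices carry the product (Borel) sigma-algebra of their entries. -/
instance instMeasurableSpaceMatrix {n p : ℕ} : MeasurableSpace (Matrix (Fin n) (Fin p) ℝ) :=
  inferInstanceAs (MeasurableSpace (Fin n → Fin p → ℝ))

/-! ### Randomized agglomerative clustering -/

/-- A cluster is a set of observations. -/
abbrev Cluster (n : ℕ) := Finset (Fin n)

/-- A candidate merge is an unordered pair `{C₁, C₂}` of distinct clusters, i.e. a set of two
clusters (see `candidates`). -/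
abbrev Merge (n : ℕ) := Finset (Cluster n)

/-- A linkage: the dissimilarity `d(M; X)` of the two clusters of `M` for the data matrix `X`. -/
abbrev Linkage (n p : ℕ) := Merge n → Matrix (Fin n) (Fin p) ℝ → ℝ

variable {n p : ℕ}

/-- All pairs of distinct clusters of the current clustering `𝒞`. -/
def candidates (𝒞 : Finset (Cluster n)) : Finset (Merge n) := 𝒞.powersetCard 2

/-- The clustering after the two clusters of `M` have been replaced by their union. -/
def mergeStep (𝒞 : Finset (Cluster n)) (M : Merge n) : Finset (Cluster n) :=
  insert (M.biUnion id) (𝒞 \ M)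

/-- The clustering after the merges `m 0, …, m (s - 1)`, starting from the singletons. It is the
clustering at which the merge `m s` is made. -/
def clusters (m : ℕ → Merge n) : ℕ → Finset (Cluster n)
  | 0 => Finset.univ.image fun i => {i}
  | s + 1 => mergeStep (clusters m s) (m s)

/-- The temperature `τ` times the average dissimilarity over the candidate merges. -/
def temperature (d : Linkage n p) (τ : ℝ) (𝒞 : Finset (Cluster n))
    (x : Matrix (Fin n) (Fin p) ℝ) : ℝ :=
  τ * ((∑ M ∈ candidates 𝒞, d M x) / ((candidates 𝒞).card : ℝ))

/-- Softmax probability of making the merge `M` when the current clustering is `𝒞` and the data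
matrix is `x`. (If the average dissimilarity vanishes, then `1 / 0 = 0` makes all candidate merges
equally likely.) -/
def mergeProb (d : Linkage n p) (τ : ℝ) (𝒞 : Finset (Cluster n)) (M : Merge n)
    (x : Matrix (Fin n) (Fin p) ℝ) : ℝ :=
  if M ∈ candidates 𝒞 then
    Real.exp (-(1 / temperature d τ 𝒞 x) * d M x) /
      ∑ M' ∈ candidates 𝒞, Real.exp (-(1 / temperature d τ 𝒞 x) * d M' x)
  else 0

/-- The information available before the merge with index `s` is drawn: the data matrix and the
merges with smaller index. -/
abbrev past {Ω : Type*} (X : Ω → Matrix (Fin n) (Fin p) ℝ) (M : ℕ → Ω → Merge n) (s : ℕ) :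
    MeasurableSpace Ω :=
  MeasurableSpace.comap X inferInstance ⊔ ⨆ r < s, MeasurableSpace.comap (M r) ⊤

/-- `M 0, …, M (T - 1)` are the first `T` merges of randomized agglomerative clustering of the
data `X`: given the data and the earlier merges, the next merge is drawn from the softmax
probabilities over the pairs of current clusters. -/
def IsRandomizedClustering {Ω : Type*} [MeasurableSpace Ω] (P : Measure Ω) (d : Linkage n p)
    (τ : ℝ) (X : Ω → Matrix (Fin n) (Fin p) ℝ) (M : ℕ → Ω → Merge n) (T : ℕ) : Prop :=
  ∀ s < T, Measurable[_, ⊤] (M s) ∧ ∀ m : Merge n,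
    P[(M s ⁻¹' {m}).indicator (fun _ => (1 : ℝ)) | past X M s] =ᵐ[P]
      fun ω => mergeProb d τ (clusters (fun r => M r ω) s) m (X ω)

/-! ### The Gaussian model -/

/-- `X` has the matrix normal law `MN(μ, I_n, S)`: its rows are independent, and row `i` is
normal with mean `μ i` and covariance `S`. -/
def HasMatrixNormalLaw {Ω : Type*} [MeasurableSpace Ω] (P : Measure Ω)
    (X : Ω → Matrix (Fin n) (Fin p) ℝ) (μ : Matrix (Fin n) (Fin p) ℝ)
    (S : Matrix (Fin p) (Fin p) ℝ) : Prop :=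
  (∀ i, P.map (fun ω => WithLp.toLp 2 (X ω i)) = multivariateGaussian (WithLp.toLp 2 (μ i)) S) ∧
    iIndepFun (fun i ω => WithLp.toLp 2 (X ω i)) P

/-- The mean `(1 / |C|) ∑ i ∈ C, μ i` of the rows of `μ` in the cluster `C`. -/
def clusterMean (μ : Matrix (Fin n) (Fin p) ℝ) (C : Cluster n) : Fin p → ℝ :=
  (1 / (C.card : ℝ)) • ∑ i ∈ C, μ i

/-! ### Test statistic and auxiliary statistics -/

/-- The contrast vector `ν`, with `νᵀ X` the difference of the two cluster means. -/
def contrast (C₁ C₂ : Cluster n) : EuclideanSpace ℝ (Fin n) :=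
  WithLp.toLp 2 fun i =>
    (if i ∈ C₁ then 1 / (C₁.card : ℝ) else 0) - (if i ∈ C₂ then 1 / (C₂.card : ℝ) else 0)

/-- The whitened mean difference `S^{-1/2} Xᵀ ν`. -/
def whitened (S : Matrix (Fin p) (Fin p) ℝ) (ν : EuclideanSpace ℝ (Fin n))
    (x : Matrix (Fin n) (Fin p) ℝ) : EuclideanSpace ℝ (Fin p) :=
  WithLp.toLp 2 ((CFC.sqrt S)⁻¹ *ᵥ (xᵀ *ᵥ ν.ofLp))

/-- The test statistic `U = ‖S^{-1/2} Xᵀ ν‖`. -/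
def statU (S : Matrix (Fin p) (Fin p) ℝ) (ν : EuclideanSpace ℝ (Fin n))
    (x : Matrix (Fin n) (Fin p) ℝ) : ℝ :=
  ‖whitened S ν x‖

/-- The direction `v / ‖v‖` of a vector (and `0` for `v = 0`). -/
def dir (v : EuclideanSpace ℝ (Fin p)) : EuclideanSpace ℝ (Fin p) := ‖v‖⁻¹ • v

/-- The auxiliary statistics `(ξ, π)`: the direction of the whitened mean difference, and the
projection `(I - ν νᵀ / ‖ν‖²) X` of the data. -/
def auxStat (S : Matrix (Fin p) (Fin p) ℝ) (ν : EuclideanSpace ℝ (Fin n))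
    (x : Matrix (Fin n) (Fin p) ℝ) : EuclideanSpace ℝ (Fin p) × Matrix (Fin n) (Fin p) ℝ :=
  (dir (whitened S ν x), (1 - (1 / ‖ν‖ ^ 2) • vecMulVec ν.ofLp ν.ofLp) * x)

/-- The data matrix `X(u; a) = u (ν / ‖ν‖²) ξᵀ S^{1/2} + π` with test statistic `u` and auxiliary
statistics `a = (ξ, π)`. -/
def reconstruct (S : Matrix (Fin p) (Fin p) ℝ) (ν : EuclideanSpace ℝ (Fin n))
    (a : EuclideanSpace ℝ (Fin p) × Matrix (Fin n) (Fin p) ℝ) (u : ℝ) :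
    Matrix (Fin n) (Fin p) ℝ :=
  (u / ‖ν‖ ^ 2) • vecMulVec ν.ofLp (a.1.ofLp ᵥ* CFC.sqrt S) + a.2

/-- The density of the `χ_p` distribution (`p ≥ 1`). -/
def chiDensity (p : ℕ) (u : ℝ) : ℝ :=
  if 0 < u then
    u ^ (p - 1) * Real.exp (-u ^ 2 / 2) / (2 ^ ((p : ℝ) / 2 - 1) * Real.Gamma ((p : ℝ) / 2))
  else 0

/-- The density of `c · χ_p` for `c > 0`. -/
def scaledChiDensity (c : ℝ) (p : ℕ) (u : ℝ) : ℝ := c⁻¹ * chiDensity p (u / c)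

/-- The `‖ν‖ · χ_p` density times the product of the softmax probabilities of the merges
`m 0, …, m t`, evaluated at the data matrix `X(u; a)`. -/
def selectiveWeight (d : Linkage n p) (τ : ℝ) (S : Matrix (Fin p) (Fin p) ℝ)
    (ν : EuclideanSpace ℝ (Fin n)) (m : ℕ → Merge n) (t : ℕ)
    (a : EuclideanSpace ℝ (Fin p) × Matrix (Fin n) (Fin p) ℝ) (u : ℝ) : ℝ :=
  scaledChiDensity ‖ν‖ p u *
    ∏ s ∈ Finset.range (t + 1), mergeProb d τ (clusters m s) (m s) (reconstruct S ν a u)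

end RandClust

end

/-! The selection event is handled through its conditional probability given the data. By the chain
rule, the probability of `E` given `X = x` is the product `G x` of the softmax probabilities along
the observed merges, so on `E` the law of `X` is the Gaussian law reweighted by `G`
(`map_restrict_merges`). As `G` is positive everywhere, `E` is not null.

Without selection, `U` and `A` are independent (`exists_map_auxStat_statU`). Under the null the
whitened mean difference is a centred isotropic Gaussian vector, so its norm and its direction are
independent. It is also independent of the residual `π`, because `Xᵀν` and `π` are jointly Gaussian
and uncorrelated. Thus `(A, U)` has law `α ⊗ ρ`, where `ρ` is a multiple of the `‖ν‖ χ_p` law.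

Since `X` is recovered exactly from `(A, U)` (`reconstruct_auxStat`), `G` is a function of `(A, U)`.
On `E` that pair therefore has, up to a constant, density `w a u` with respect to `α ⊗ Lebesgue`.
Normalizing in `u` for fixed `a` gives the conditional law (`condDistrib_ae_eq_normalizedKernel`).
All constants cancel there, so neither the sphere's area nor the mass of the chi density is ever
computed. -/

namespace RandClust

variable {n p : ℕ}

/-! ### Combinatorics of the clusterings and of the contrast vector -/

section Clusters

/-- Along a sequence of admissible merges the clusters stay nonempty and pairwise disjoint. -/
lemma clusters_nonempty_disjoint {m : ℕ → Merge n} {s : ℕ}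
    (hm : ∀ r < s, m r ∈ candidates (clusters m r)) :
    (∀ C ∈ clusters m s, C.Nonempty) ∧
      ∀ C ∈ clusters m s, ∀ C' ∈ clusters m s, C ≠ C' → Disjoint C C' := by
  induction s with
  | zero =>
    simp only [clusters, Finset.mem_image, Finset.mem_univ, true_and]
    refine ⟨?_, ?_⟩
    · rintro _ ⟨i, rfl⟩
      exact Finset.singleton_nonempty i
    · rintro _ ⟨i, rfl⟩ _ ⟨j, rfl⟩ hij
      simpa using fun h : i = j => hij (by rw [h])
  | succ s ih =>
    obtain ⟨hne, hdisj⟩ := ih fun r hr => hm r (by lia)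
    have hms := hm s (by lia)
    simp only [candidates, Finset.mem_powersetCard] at hms
    have key : ∀ C ∈ clusters m s \ m s, Disjoint ((m s).biUnion id) C := by
      intro C hC
      rw [Finset.mem_sdiff] at hC
      rw [Finset.disjoint_biUnion_left]
      intro D hD
      exact hdisj D (hms.1 hD) C hC.1 fun h => hC.2 (h ▸ hD)
    simp only [clusters, mergeStep, Finset.mem_insert]
    refine ⟨?_, ?_⟩
    · rintro C (rfl | hC)
      · obtain ⟨D, hD⟩ := Finset.card_pos.1 (show 0 < (m s).card by lia)
        obtain ⟨i, hi⟩ := hne D (hms.1 hD)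
        exact ⟨i, Finset.mem_biUnion.2 ⟨D, hD, hi⟩⟩
      · exact hne C (Finset.mem_sdiff.1 hC).1
    · rintro C (rfl | hC) C' (rfl | hC') h
      · exact absurd rfl h
      · exact key C' hC'
      · exact (key C hC).symm
      · exact hdisj C (Finset.mem_sdiff.1 hC).1 C' (Finset.mem_sdiff.1 hC').1 h

lemma clusters_congr {m m' : ℕ → Merge n} {s : ℕ} (h : ∀ r < s, m r = m' r) :
    clusters m s = clusters m' s := by
  induction s with
  | zero => rfl
  | succ s ih => simp only [clusters, ih fun r hr => h r (by lia), h s (by lia)]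

lemma contrast_ne_zero {C₁ C₂ : Cluster n} (h₁ : C₁.Nonempty) (h : Disjoint C₁ C₂) :
    contrast C₁ C₂ ≠ 0 := by
  obtain ⟨i, hi⟩ := h₁
  intro h0
  have := congrArg (fun v => v.ofLp i) h0
  have hi2 : i ∉ C₂ := Finset.disjoint_left.1 h hi
  simp [contrast, hi, hi2] at this
  -- The `i`-th entry of the contrast being zero has been reduced to `C₁ = ∅`.
  simp [this] at hi

lemma clusterMean_apply (μ : Matrix (Fin n) (Fin p) ℝ) (C : Cluster n) (j : Fin p) :
    clusterMean μ C j = ∑ i ∈ C, (C.card : ℝ)⁻¹ * μ i j := by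
  rw [clusterMean, one_div, Pi.smul_apply, smul_eq_mul, ← Finset.mul_sum]
  exact congrArg _ (Finset.sum_apply j C fun i => μ i)

lemma sum_contrast_mul {C₁ C₂ : Cluster n} {μ : Matrix (Fin n) (Fin p) ℝ}
    (h : clusterMean μ C₁ = clusterMean μ C₂) (j : Fin p) :
    ∑ i, (contrast C₁ C₂).ofLp i * μ i j = 0 := by
  have : ∑ i, (contrast C₁ C₂).ofLp i * μ i j = clusterMean μ C₁ j - clusterMean μ C₂ j := by
    simp [contrast, clusterMean_apply, sub_mul, ite_mul, Finset.sum_sub_distrib,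
      Finset.sum_ite_mem]
  rw [this, h, sub_self]

end Clusters

/-! ### Softmax probabilities -/

section MergeProb

variable {d : Linkage n p} {τ : ℝ} {𝒞 : Finset (Cluster n)} {M : Merge n}
  {x : Matrix (Fin n) (Fin p) ℝ}

/-- Exponentials are positive whatever the sign of the temperature, and also when it is `0`. -/
lemma mergeProb_pos (hM : M ∈ candidates 𝒞) : 0 < mergeProb d τ 𝒞 M x := by
  rw [mergeProb, if_pos hM]
  exact div_pos (Real.exp_pos _) (Finset.sum_pos (fun _ _ => Real.exp_pos _) ⟨M, hM⟩)

lemma mergeProb_nonneg : 0 ≤ mergeProb d τ 𝒞 M x := by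
  by_cases hM : M ∈ candidates 𝒞
  · exact (mergeProb_pos hM).le
  · rw [mergeProb, if_neg hM]

lemma mergeProb_le_one : mergeProb d τ 𝒞 M x ≤ 1 := by
  rw [mergeProb]
  split_ifs with hM
  · refine div_le_one_of_le₀ ?_ (Finset.sum_nonneg fun _ _ => (Real.exp_pos _).le)
    exact Finset.single_le_sum (f := fun M' => Real.exp (-(1 / temperature d τ 𝒞 x) * d M' x))
      (fun _ _ => (Real.exp_pos _).le) hM
  · exact zero_le_one

lemma measurable_mergeProb (hd : ∀ M, Measurable (d M)) :
    Measurable fun x => mergeProb d τ 𝒞 M x := by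
  have hT : Measurable fun x => temperature d τ 𝒞 x := by
    unfold temperature
    exact ((Finset.measurable_sum _ fun M _ => hd M).div_const _).const_mul τ
  have he : ∀ M', Measurable fun x => Real.exp (-(1 / temperature d τ 𝒞 x) * d M' x) := fun M' =>
    (((hT.const_div 1).neg).mul (hd M')).exp
  unfold mergeProb
  split_ifs
  · exact (he M).div (Finset.measurable_sum _ fun M' _ => he M')
  · exact measurable_const

end MergeProb

/-! ### Chain rule for the merges -/

section RestrictedLaw

/-- These are the events over which the conditional probability of the next merge gets integrated.
-/
lemma measurableSet_past {Ω : Type*} {X : Ω → Matrix (Fin n) (Fin p) ℝ}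
    {M : ℕ → Ω → Merge n} (m : ℕ → Merge n) {B : Set (Matrix (Fin n) (Fin p) ℝ)}
    (hB : MeasurableSet B) (s : ℕ) :
    MeasurableSet[past X M s] (X ⁻¹' B ∩ {ω | ∀ r < s, M r ω = m r}) := by
  refine MeasurableSet.inter ?_ ?_
  · exact (le_sup_left : _ ≤ past X M s) _ ⟨B, hB, rfl⟩
  · have : {ω | ∀ r < s, M r ω = m r} = ⋂ r, ⋂ (_ : r < s), M r ⁻¹' {m r} := by
      ext; simp
    rw [this]
    refine MeasurableSet.iInter fun r => MeasurableSet.iInter fun hr => ?_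
    refine (le_sup_of_le_right (le_iSup₂_of_le r hr le_rfl) : _ ≤ past X M s) _ ?_
    exact ⟨{m r}, trivial, rfl⟩

variable {Ω : Type*} [MeasurableSpace Ω] {P : Measure Ω}
  {d : Linkage n p} {τ : ℝ} {X : Ω → Matrix (Fin n) (Fin p) ℝ} {M : ℕ → Ω → Merge n} {T : ℕ}

lemma past_le (hX : Measurable X) (hM : IsRandomizedClustering P d τ X M T) {s : ℕ} (hs : s ≤ T) :
    past X M s ≤ ‹MeasurableSpace Ω› := by
  refine sup_le hX.comap_le (iSup₂_le fun r hr => ?_)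
  exact (hM r (by lia)).1.comap_le

/-- On the event that the first `s` merges are `m 0, …, m (s - 1)`, the law of the data has the
product of the corresponding merge probabilities as its density. -/
lemma map_restrict_merges [IsProbabilityMeasure P] (hd : ∀ M, Measurable (d M)) (hX : Measurable X)
    (hM : IsRandomizedClustering P d τ X M T) (m : ℕ → Merge n) {s : ℕ} (hs : s ≤ T) :
    (P.restrict {ω | ∀ r < s, M r ω = m r}).map X =
      (P.map X).withDensity fun x =>
        ENNReal.ofReal (∏ r ∈ Finset.range s, mergeProb d τ (clusters m r) (m r) x) := by
  induction s with
  | zero => simp [Pi.one_def.symm, withDensity_one]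
  | succ s ih =>
    have ih := ih (by lia)
    obtain ⟨hMs, hcond⟩ := hM s (by lia)
    have hle := past_le hX hM (show s ≤ T by lia)
    set g : Matrix (Fin n) (Fin p) ℝ → ℝ := fun x => mergeProb d τ (clusters m s) (m s) x with hg
    have hgm : Measurable g := measurable_mergeProb hd
    have hms : MeasurableSet (M s ⁻¹' {m s}) := hMs trivial
    ext B hB
    set F := X ⁻¹' B ∩ {ω | ∀ r < s, M r ω = m r} with hF
    have hFp : MeasurableSet[past X M s] F := measurableSet_past m hB s
    have hFm : MeasurableSet F := hle _ hFp
    have hint : Integrable ((M s ⁻¹' {m s}).indicator fun _ => (1 : ℝ)) P :=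
      (integrable_const 1).indicator hms
    -- `F` belongs to the past, so the indicator of the next merge may be replaced by its
    -- conditional expectation. On `F` the random history is `m`, so the current clustering is
    -- deterministic.
    have h1 : P.real (F ∩ M s ⁻¹' {m s}) = ∫ ω in F, g (X ω) ∂P := by
      calc P.real (F ∩ M s ⁻¹' {m s})
          = ∫ ω in F, (M s ⁻¹' {m s}).indicator (fun _ => (1 : ℝ)) ω ∂P := by
            rw [setIntegral_indicator hms]; simp
        _ = ∫ ω in F, (P[(M s ⁻¹' {m s}).indicator (fun _ => (1 : ℝ)) | past X M s]) ω ∂P :=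
            (setIntegral_condExp hle hint hFp).symm
        _ = ∫ ω in F, mergeProb d τ (clusters (fun r => M r ω) s) (m s) (X ω) ∂P :=
            integral_congr_ae (ae_restrict_of_ae (hcond (m s)))
        _ = ∫ ω in F, g (X ω) ∂P := by
            refine setIntegral_congr_fun hFm fun ω hω => ?_
            simp only [hg]
            rw [clusters_congr (m := fun r => M r ω) (m' := m) fun r hr => hω.2 r hr]
    have h2 : P (F ∩ M s ⁻¹' {m s}) = ∫⁻ ω in F, ENNReal.ofReal (g (X ω)) ∂P := by
      rw [← ofReal_integral_eq_lintegral_ofReal, ← h1, ofReal_measureReal]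
      · refine Integrable.of_bound (hgm.comp hX).aestronglyMeasurable 1 (ae_of_all _ fun ω => ?_)
        rw [Real.norm_of_nonneg mergeProb_nonneg]
        exact mergeProb_le_one
      · exact ae_of_all _ fun ω => mergeProb_nonneg
    have h3 : X ⁻¹' B ∩ {ω | ∀ r < s + 1, M r ω = m r} = F ∩ M s ⁻¹' {m s} := by
      ext ω
      simp only [hF, mem_inter_iff, mem_preimage, mem_ofPred_eq, mem_singleton_iff, and_assoc,
        Nat.forall_lt_succ_right]
    have hGm : Measurable fun x => ENNReal.ofReal
        (∏ r ∈ Finset.range s, mergeProb d τ (clusters m r) (m r) x) :=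
      (Finset.measurable_prod _ fun r _ => measurable_mergeProb hd).ennreal_ofReal
    rw [Measure.map_apply hX hB, Measure.restrict_apply (hX hB), h3, h2,
      withDensity_apply _ hB, hF, ← Measure.restrict_restrict (hX hB),
      ← setLIntegral_map hB (f := fun x => ENNReal.ofReal (g x)) hgm.ennreal_ofReal hX, ih,
      setLIntegral_withDensity_eq_setLIntegral_mul _ hGm hgm.ennreal_ofReal hB]
    refine lintegral_congr fun x => ?_
    rw [Finset.prod_range_succ, ENNReal.ofReal_mul
      (Finset.prod_nonneg fun r _ => mergeProb_nonneg)]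
    rfl

end RestrictedLaw

/-! ### Polar coordinates -/

section Polar

variable {E : Type*} [NormedAddCommGroup E] [InnerProductSpace ℝ E] [FiniteDimensional ℝ E]
  [MeasurableSpace E] [BorelSpace E] [Nontrivial E]

open Module

/-- Integration in polar coordinates of a function of the direction and the norm. -/
lemma lintegral_dir_norm {F : E × ℝ → ENNReal} (hF : Measurable F) :
    ∫⁻ x : E, F (‖x‖⁻¹ • x, ‖x‖) =
      ∫⁻ r in Ioi (0 : ℝ), ENNReal.ofReal (r ^ (finrank ℝ E - 1)) *
        ∫⁻ e, F (e, r) ∂((volume : Measure E).toSphere.map (Subtype.val)) := by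
  have hFr : ∀ r, Measurable fun e => F (e, r) := fun r => hF.comp (by fun_prop)
  have hms : MeasurableSet ({0}ᶜ : Set E) := (measurableSet_singleton 0).compl
  calc ∫⁻ x : E, F (‖x‖⁻¹ • x, ‖x‖)
      -- The origin is a null set because the space is nontrivial.
      = ∫⁻ x in ({0}ᶜ : Set E), F (‖x‖⁻¹ • x, ‖x‖) := by rw [restrict_compl_singleton]
    _ = ∫⁻ x : ({0}ᶜ : Set E), F (‖x.1‖⁻¹ • x.1, ‖x.1‖) ∂((volume : Measure E).comap (↑)) :=
        (lintegral_subtype_comap hms _).symm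
    _ = ∫⁻ z, F (z.1.1, z.2.1)
          ∂((volume : Measure E).toSphere.prod (.volumeIoiPow (finrank ℝ E - 1))) := by
        simpa using! (volume : Measure E).measurePreserving_homeomorphUnitSphereProd.lintegral_comp
          (hF.comp (by fun_prop : Measurable fun z :
            Metric.sphere (0 : E) 1 × Ioi (0 : ℝ) => ((z.1 : E), (z.2 : ℝ))))
    _ = ∫⁻ r : Ioi (0 : ℝ), ∫⁻ e, F (e.1, r.1) ∂((volume : Measure E).toSphere)
          ∂(.volumeIoiPow (finrank ℝ E - 1)) :=
        lintegral_prod_symm' _ (hF.comp (by fun_prop))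
    _ = ∫⁻ r : Ioi (0 : ℝ), ENNReal.ofReal (r.1 ^ (finrank ℝ E - 1)) *
          ∫⁻ e, F (e.1, r.1) ∂((volume : Measure E).toSphere) ∂(.comap Subtype.val volume) := by
        rw [Measure.volumeIoiPow, lintegral_withDensity_eq_lintegral_mul _ (by fun_prop)]
        · rfl
        · exact (hF.comp (by fun_prop : Measurable fun z :
            Ioi (0 : ℝ) × Metric.sphere (0 : E) 1 => ((z.2 : E), (z.1 : ℝ)))).lintegral_prod_right'
    _ = _ := by
        rw [← lintegral_subtype_comap measurableSet_Ioi]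
        refine lintegral_congr fun r => ?_
        rw [lintegral_map (hFr _) measurable_subtype_coe]

/-- For a law with a radial density, direction and norm are independent. -/
lemma map_dir_norm_withDensity {g : ℝ → ENNReal} (hg : Measurable g) :
    ((volume : Measure E).withDensity fun x => g ‖x‖).map (fun x => (‖x‖⁻¹ • x, ‖x‖)) =
      ((volume : Measure E).toSphere.map (Subtype.val)).prod
        ((volume.restrict (Ioi (0 : ℝ))).withDensity fun r =>
          ENNReal.ofReal (r ^ (finrank ℝ E - 1)) * g r) := by
  refine Measure.ext_of_lintegral _ fun F hF => ?_
  have hm : Measurable fun x : E => (‖x‖⁻¹ • x, ‖x‖) := by fun_prop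
  have hFi : Measurable fun r : ℝ =>
      ∫⁻ e, F (e, r) ∂((volume : Measure E).toSphere.map (Subtype.val)) := hF.lintegral_prod_left'
  rw [lintegral_map hF hm, lintegral_withDensity_eq_lintegral_mul _ (by fun_prop)
      (show Measurable fun x : E => F (‖x‖⁻¹ • x, ‖x‖) from hF.comp hm),
    lintegral_prod_symm' _ hF,
    lintegral_withDensity_eq_lintegral_mul _ (by fun_prop) hFi]
  have := lintegral_dir_norm (E := E) (F := fun z => g z.2 * F z)
    ((hg.comp measurable_snd).mul hF)
  simp only [Pi.mul_apply] at this ⊢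
  rw [this]
  refine lintegral_congr fun r => ?_
  have hFr : Measurable fun e => F (e, r) := hF.comp (by fun_prop)
  rw [lintegral_const_mul _ hFr, mul_assoc]

end Polar

/-! ### Radial density of an isotropic Gaussian law -/

section GaussianDensity

variable {E : Type*} [NormedAddCommGroup E] [InnerProductSpace ℝ E] [FiniteDimensional ℝ E]
  [MeasurableSpace E] [BorelSpace E]

open Module

lemma integrable_exp_neg_norm_sq {c : ℝ} (hc : 0 < c) :
    Integrable fun x : E => Real.exp (-(‖x‖ / c) ^ 2 / 2) := by
  have h := GaussianFourier.integrable_cexp_neg_mul_sq_norm_add (V := E)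
    (b := ((1 / (2 * c ^ 2) : ℝ) : ℂ)) (by rw [Complex.ofReal_re]; positivity) 0 0
  refine h.re.congr (ae_of_all _ fun x => ?_)
  have : (-((1 / (2 * c ^ 2) : ℝ) : ℂ) * (‖x‖ : ℂ) ^ 2 + 0 * (inner ℝ 0 x : ℝ)) =
      ((-(‖x‖ / c) ^ 2 / 2 : ℝ) : ℂ) := by
    push_cast
    field_simp
    ring
  simp only [this]
  exact Complex.exp_ofReal_re _

/-- A centred isotropic Gaussian law has a radial density. -/
lemma exists_eq_withDensity_of_charFun {c : ℝ} (hc : 0 < c) {Q : Measure E}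
    [IsProbabilityMeasure Q] (hQ : ∀ t, charFun Q t = Complex.exp (-(c ^ 2 * ‖t‖ ^ 2) / 2)) :
    ∃ K : ℝ, 0 < K ∧ Q = volume.withDensity fun x =>
      ENNReal.ofReal (K * Real.exp (-(‖x‖ / c) ^ 2 / 2)) := by
  set b : ℂ := ((1 / (2 * c ^ 2) : ℝ) : ℂ) with hb
  have hbre : 0 < b.re := by rw [hb, Complex.ofReal_re]; positivity
  -- The reciprocal of the Gaussian integral `(π / b) ^ (dim / 2)`.
  set K : ℝ := (Real.pi / (1 / (2 * c ^ 2))) ^ (-(finrank ℝ E / 2 : ℝ)) with hK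
  have hKpos : 0 < K := by positivity
  refine ⟨K, hKpos, ?_⟩
  have hint := (integrable_exp_neg_norm_sq (E := E) hc).const_mul K
  have : IsFiniteMeasure ((volume : Measure E).withDensity fun x =>
      ENNReal.ofReal (K * Real.exp (-(‖x‖ / c) ^ 2 / 2))) :=
    isFiniteMeasure_withDensity_ofReal hint.2
  refine Measure.ext_of_charFun ?_
  ext t
  rw [hQ, charFun_apply, integral_withDensity_eq_integral_toReal_smul (by fun_prop)
    (ae_of_all _ fun _ => ENNReal.ofReal_lt_top)]
  -- With linear coefficient `I` the Gaussian integral is a characteristic function; its exponent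
  -- `I² ‖t‖² / (4b)` equals `-c² ‖t‖² / 2`.
  have h := GaussianFourier.integral_cexp_neg_mul_sq_norm_add (V := E) hbre Complex.I t
  have hKc : ((Real.pi : ℂ) / b) ^ (finrank ℝ E / 2 : ℂ) = ((K⁻¹ : ℝ) : ℂ) := by
    rw [hK, ← Real.rpow_neg (by positivity), neg_neg, Complex.ofReal_cpow (by positivity)]
    push_cast [hb]
    rfl
  rw [hKc] at h
  have h2 : ∀ x : E, (ENNReal.ofReal (K * Real.exp (-(‖x‖ / c) ^ 2 / 2))).toReal •
      Complex.exp ((inner ℝ x t : ℝ) * Complex.I) =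
      K * Complex.exp (-b * (‖x‖ : ℂ) ^ 2 + Complex.I * (inner ℝ t x : ℝ)) := by
    intro x
    rw [ENNReal.toReal_ofReal (by positivity), Complex.exp_add, real_inner_comm, Complex.real_smul]
    push_cast [hb]
    rw [mul_assoc, mul_comm Complex.I]
    congr 3
    field_simp
  simp_rw [h2]
  rw [integral_const_mul, h, ← mul_assoc, ← Complex.ofReal_mul, mul_inv_cancel₀ hKpos.ne',
    Complex.ofReal_one, one_mul, Complex.I_sq]
  congr 1
  push_cast [hb]
  field_simp
  ring

end GaussianDensity

/-! ### Square root of the covariance and reconstruction of the data -/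

section SquareRoot

variable {S : Matrix (Fin p) (Fin p) ℝ}

lemma isUnit_det_sqrt (hS : S.PosDef) : IsUnit (CFC.sqrt S).det := by
  have h : (CFC.sqrt S).det * (CFC.sqrt S).det = S.det := by
    rw [← det_mul, CFC.sqrt_mul_sqrt_self _ hS.posSemidef.nonneg]
  refine isUnit_iff_ne_zero.2 fun h0 => hS.det_pos.ne' ?_
  rw [← h, h0, zero_mul]

lemma transpose_sqrt : (CFC.sqrt S)ᵀ = CFC.sqrt S := by
  have h := (CFC.sqrt_nonneg S).isSelfAdjoint
  rwa [IsSelfAdjoint, star_eq_conjTranspose, conjTranspose_eq_transpose_of_trivial] at h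

end SquareRoot

section Reconstruct

variable {S : Matrix (Fin p) (Fin p) ℝ} {ν : EuclideanSpace ℝ (Fin n)}

/-- Including `v = 0` makes the reconstruction of the data hold everywhere, not only almost
everywhere. -/
lemma norm_smul_dir (v : EuclideanSpace ℝ (Fin p)) : ‖v‖ • dir v = v := by
  by_cases hv : v = 0
  · simp [hv, dir]
  · rw [dir, smul_smul, mul_inv_cancel₀ (norm_ne_zero_iff.2 hv), one_smul]

lemma auxStat_snd_apply (x : Matrix (Fin n) (Fin p) ℝ) (i : Fin n) (j : Fin p) :
    (auxStat S ν x).2 i j = x i j - ν.ofLp i / ‖ν‖ ^ 2 * ∑ k, ν.ofLp k * x k j := by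
  simp only [auxStat]
  rw [Matrix.sub_mul, Matrix.one_mul, Matrix.sub_apply, Matrix.smul_mul, Matrix.smul_apply,
    smul_eq_mul, Matrix.mul_apply, Finset.mul_sum, Finset.mul_sum]
  congr 1
  refine Finset.sum_congr rfl fun k _ => ?_
  rw [vecMulVec_apply]
  ring

/-- The data can be recovered from the test statistic and the auxiliary statistics. -/
lemma reconstruct_auxStat (hS : S.PosDef) (x : Matrix (Fin n) (Fin p) ℝ) :
    reconstruct S ν (auxStat S ν x) (statU S ν x) = x := by
  have hW : (whitened S ν x).ofLp ᵥ* CFC.sqrt S = xᵀ *ᵥ ν.ofLp := by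
    rw [← mulVec_transpose, transpose_sqrt, whitened, mulVec_mulVec,
      mul_nonsing_inv _ (isUnit_det_sqrt hS), one_mulVec]
  have hd : statU S ν x • ((auxStat S ν x).1.ofLp ᵥ* CFC.sqrt S) = xᵀ *ᵥ ν.ofLp := by
    rw [← hW, ← smul_vecMul, ← WithLp.ofLp_smul, statU, auxStat, norm_smul_dir]
  ext i j
  have hj := congrFun hd j
  simp only [Pi.smul_apply, smul_eq_mul] at hj
  simp only [reconstruct, Matrix.add_apply, Matrix.smul_apply, vecMulVec_apply, smul_eq_mul]
  -- The rank-one term is `ν νᵀ x / ‖ν‖²`, exactly what the projection removed.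
  have e : statU S ν x / ‖ν‖ ^ 2 * (ν.ofLp i * ((auxStat S ν x).1.ofLp ᵥ* CFC.sqrt S) j) =
      1 / ‖ν‖ ^ 2 * ν.ofLp i * (xᵀ *ᵥ ν.ofLp) j := by rw [← hj]; ring
  rw [e, auxStat_snd_apply]
  simp only [mulVec, dotProduct, transpose_apply, mul_comm (x _ j)]
  ring

end Reconstruct

/-! ### Measurability and rearrangement of product measures -/

section Measurability

variable (S : Matrix (Fin p) (Fin p) ℝ) (ν : EuclideanSpace ℝ (Fin n))

lemma measurable_entry (i : Fin n) (j : Fin p) :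
    Measurable fun x : Matrix (Fin n) (Fin p) ℝ => x i j :=
  (measurable_pi_apply j).comp (measurable_pi_apply i)

lemma measurable_matrix {α : Type*} [MeasurableSpace α] {f : α → Matrix (Fin n) (Fin p) ℝ}
    (h : ∀ i j, Measurable fun a => f a i j) : Measurable f :=
  measurable_pi_lambda _ fun i => measurable_pi_lambda _ fun j => h i j

lemma measurable_whitened : Measurable (whitened S ν) := by
  refine (WithLp.measurable_toLp 2 _).comp (measurable_pi_lambda _ fun k => ?_)
  simp only [mulVec, dotProduct, transpose_apply]
  exact Finset.measurable_sum _ fun j _ =>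
    (Finset.measurable_sum _ fun i _ => (measurable_entry i j).mul_const _).const_mul _

lemma measurable_statU : Measurable (statU S ν) := (measurable_whitened S ν).norm

lemma measurable_dir : Measurable (dir (p := p)) := by
  unfold dir; fun_prop

lemma measurable_auxStat : Measurable (auxStat S ν) := by
  refine (measurable_dir.comp (measurable_whitened S ν)).prodMk (measurable_matrix fun i j => ?_)
  simp only [Matrix.mul_apply]
  exact Finset.measurable_sum _ fun k _ => (measurable_entry k j).const_mul _

lemma measurable_reconstruct :
    Measurable fun z : (EuclideanSpace ℝ (Fin p) × Matrix (Fin n) (Fin p) ℝ) × ℝ =>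
      reconstruct S ν z.1 z.2 := by
  refine measurable_matrix fun i j => ?_
  simp only [reconstruct, Matrix.add_apply, Matrix.smul_apply, vecMulVec_apply, smul_eq_mul,
    vecMul, dotProduct]
  refine Measurable.add ?_ ((measurable_entry i j).comp (by fun_prop))
  fun_prop

end Measurability

section Product

variable {α β γ : Type*} [MeasurableSpace α] [MeasurableSpace β] [MeasurableSpace γ]

/-- Tonelli's theorem; it regroups `((ξ, U), π)` as `((ξ, π), U)`. -/
lemma map_prod_prod_right_comm (κ : Measure α) (ρ : Measure β) (π : Measure γ) [SFinite κ]
    [SFinite ρ] [SFinite π] :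
    ((κ.prod ρ).prod π).map (fun z => ((z.1.1, z.2), z.1.2)) = (κ.prod π).prod ρ := by
  refine Measure.ext_of_lintegral _ fun F hF => ?_
  have hΦ : Measurable fun z : (α × β) × γ => F ((z.1.1, z.2), z.1.2) := hF.comp (by fun_prop)
  have h1 : Measurable fun z : α × β => ∫⁻ c, F ((z.1, c), z.2) ∂π := hΦ.lintegral_prod_right'
  have h2 : Measurable fun z : α × γ => ∫⁻ y, F (z, y) ∂ρ := hF.lintegral_prod_right'
  rw [lintegral_map hF (by fun_prop), lintegral_prod _ hΦ.aemeasurable,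
    lintegral_prod _ h1.aemeasurable, lintegral_prod _ hF.aemeasurable,
    lintegral_prod _ h2.aemeasurable]
  refine lintegral_congr fun x => lintegral_lintegral_swap ?_
  exact (hF.comp (by fun_prop : Measurable fun w : β × γ => ((x, w.2), w.1))).aemeasurable

end Product

/-! ### From the radial density to the chi density -/

section ChiDensity

/-- The radial part of a Gaussian density is, up to a constant, the scaled chi density. -/
lemma exists_withDensity_eq_scaledChiDensity (hp : 0 < p) {c K : ℝ} (hc : 0 < c) (hK : 0 < K) :
    ∃ L : ℝ, 0 < L ∧
      (volume.restrict (Ioi (0 : ℝ))).withDensity (fun r =>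
        ENNReal.ofReal (r ^ (p - 1)) * ENNReal.ofReal (K * Real.exp (-(r / c) ^ 2 / 2))) =
      volume.withDensity fun u => ENNReal.ofReal (L * scaledChiDensity c p u) := by
  -- `D` collects the constants of `scaledChiDensity`, which is `D * r ^ (p - 1) * exp (-(r / c)² /
  -- 2)` for `r > 0`.
  set D := c⁻¹ * ((c⁻¹) ^ (p - 1) / (2 ^ ((p : ℝ) / 2 - 1) * Real.Gamma ((p : ℝ) / 2)))
    with hD
  have hDpos : 0 < D := by
    have := Real.Gamma_pos_of_pos (show (0 : ℝ) < p / 2 by positivity)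
    positivity
  refine ⟨K / D, by positivity, ?_⟩
  rw [← withDensity_indicator measurableSet_Ioi]
  congr 1
  ext1 r
  by_cases hr : 0 < r
  · have hr' : 0 < r / c := div_pos hr hc
    rw [indicator_of_mem (mem_Ioi.2 hr), ← ENNReal.ofReal_mul (by positivity),
      scaledChiDensity, chiDensity, if_pos hr']
    congr 1
    have e : c⁻¹ * ((r / c) ^ (p - 1) * Real.exp (-(r / c) ^ 2 / 2) /
        (2 ^ ((p : ℝ) / 2 - 1) * Real.Gamma ((p : ℝ) / 2))) =
        D * (r ^ (p - 1) * Real.exp (-(r / c) ^ 2 / 2)) := by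
      rw [hD, div_eq_mul_inv r, mul_pow]
      ring
    rw [mul_left_comm, e, ← mul_assoc (K / D), div_mul_cancel₀ _ hDpos.ne']
  · have hr' : ¬ 0 < r / c := fun h' => hr ((div_pos_iff_of_pos_right hc).1 h')
    rw [indicator_of_notMem (by simpa using hr), scaledChiDensity, chiDensity, if_neg hr']
    simp

end ChiDensity

/-! ### Independence of the test statistic and the auxiliary statistics -/

section Gaussian

variable {Ω : Type*} [MeasurableSpace Ω] {P : Measure Ω}
  {X : Ω → Matrix (Fin n) (Fin p) ℝ} {μ : Matrix (Fin n) (Fin p) ℝ}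
  {S : Matrix (Fin p) (Fin p) ℝ}

lemma measurable_row (hX : Measurable X) (i : Fin n) :
    Measurable fun ω => WithLp.toLp 2 (X ω i) :=
  (WithLp.measurable_toLp 2 _).comp ((measurable_pi_apply i).comp hX)

namespace HasMatrixNormalLaw

lemma hasGaussianLaw_row (h : HasMatrixNormalLaw P X μ S) (i : Fin n) :
    HasGaussianLaw (fun ω => WithLp.toLp 2 (X ω i)) P where
  isGaussian_map := by rw [h.1 i]; infer_instance

/-- Joint Gaussianity, from independence of the rows, is what lets zero covariance imply
independence later. -/
lemma hasGaussianLaw_rows (h : HasMatrixNormalLaw P X μ S) :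
    HasGaussianLaw (fun ω i => WithLp.toLp 2 (X ω i)) P :=
  h.2.hasGaussianLaw h.hasGaussianLaw_row

lemma memLp_entry (h : HasMatrixNormalLaw P X μ S) (i : Fin n) (j : Fin p) :
    MemLp (fun ω => X ω i j) 2 P :=
  ((h.hasGaussianLaw_row i).map_fun (EuclideanSpace.proj j)).memLp_two

lemma covariance_entry (h : HasMatrixNormalLaw P X μ S) (hX : Measurable X) (hS : S.PosSemidef)
    (i k : Fin n) (j l : Fin p) :
    cov[fun ω => X ω i j, fun ω => X ω k l; P] = if i = k then S j l else 0 := by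
  split_ifs with hik
  · subst hik
    rw [← covariance_eval_multivariateGaussian (μ := WithLp.toLp 2 (μ i)) hS j l, ← h.1 i,
      covariance_map (by fun_prop) (by fun_prop) (measurable_row hX i).aemeasurable]
    rfl
  · refine IndepFun.covariance_eq_zero ?_ (h.memLp_entry i j) (h.memLp_entry k l)
    exact (h.2.indepFun hik).comp (φ := fun v => v.ofLp j) (ψ := fun v => v.ofLp l)
      (by fun_prop) (by fun_prop)

/-- The weighted sum of the rows is independent of the residuals of its projection. -/
lemma indepFun_sum_residual (h : HasMatrixNormalLaw P X μ S) (hX : Measurable X)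
    (hS : S.PosSemidef) {ν : EuclideanSpace ℝ (Fin n)} (hν : ν ≠ 0) :
    IndepFun (fun ω j => ∑ i, ν.ofLp i * X ω i j)
      (fun ω (q : Fin n × Fin p) =>
        X ω q.1 q.2 - ν.ofLp q.1 / ‖ν‖ ^ 2 * ∑ i, ν.ofLp i * X ω i q.2) P := by
  have := h.2.isProbabilityMeasure
  have hsq : ∑ i, ν.ofLp i * ν.ofLp i = ‖ν‖ ^ 2 := by
    rw [EuclideanSpace.real_norm_sq_eq]
    exact Finset.sum_congr rfl fun i _ => (sq _).symm
  have hν2 : ‖ν‖ ^ 2 ≠ 0 := pow_ne_zero 2 (norm_ne_zero_iff.2 hν)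
  let e (i : Fin n) (j : Fin p) : (Fin n → EuclideanSpace ℝ (Fin p)) →L[ℝ] ℝ :=
    (EuclideanSpace.proj j).comp (ContinuousLinearMap.proj i)
  let V (j : Fin p) : (Fin n → EuclideanSpace ℝ (Fin p)) →L[ℝ] ℝ := ∑ i, ν.ofLp i • e i j
  have hV : ∀ ω j, V j (fun i => WithLp.toLp 2 (X ω i)) = ∑ i, ν.ofLp i * X ω i j := by
    intro ω j
    simp [V, e]
  have hG := h.hasGaussianLaw_rows.map_fun ((ContinuousLinearMap.pi V).prod
    (ContinuousLinearMap.pi fun q : Fin n × Fin p =>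
      e q.1 q.2 - (ν.ofLp q.1 / ‖ν‖ ^ 2) • V q.2))
  have hm := h.memLp_entry
  have hmV : ∀ j, MemLp (fun ω => ∑ i, ν.ofLp i * X ω i j) 2 P := fun j =>
    memLp_finsetSum _ fun i _ => (hm i j).const_mul _
  have c1 : ∀ j i l, cov[fun ω => ∑ k, ν.ofLp k * X ω k j, fun ω => X ω i l; P] =
      ν.ofLp i * S j l := by
    intro j i l
    rw [covariance_fun_sum_left (fun k => (hm k j).const_mul _) (hm i l)]
    simp [covariance_const_mul_left, h.covariance_entry hX hS]
  refine HasGaussianLaw.indepFun_of_covariance_eval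
    (X := fun j ω => ∑ i, ν.ofLp i * X ω i j)
    (Y := fun (q : Fin n × Fin p) ω =>
      X ω q.1 q.2 - ν.ofLp q.1 / ‖ν‖ ^ 2 * ∑ i, ν.ofLp i * X ω i q.2) ?_ ?_
  · refine hG.congr (ae_of_all _ fun ω => ?_)
    refine Prod.ext (funext fun j => hV ω j) (funext fun q => ?_)
    simp only [ContinuousLinearMap.prod_apply, ContinuousLinearMap.pi_apply,
      _root_.sub_apply, _root_.smul_apply, hV, smul_eq_mul]
    rfl
  · rintro j ⟨i, l⟩
    dsimp only
    rw [covariance_fun_sub_right (hmV j) (hm i l) ((hmV l).const_mul _), c1,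
      covariance_const_mul_right,
      covariance_fun_sum_right (fun k => (hm k l).const_mul _) (hmV j)]
    -- The covariance is `ν_i S_jl - (ν_i / ‖ν‖²) ‖ν‖² S_jl = 0`.
    simp_rw [covariance_const_mul_right, c1, ← mul_assoc, ← Finset.sum_mul, hsq]
    field_simp
    ring

/-- Under equal cluster means the whitened mean difference is centred and isotropic. -/
lemma charFun_map_whitened (h : HasMatrixNormalLaw P X μ S) (hX : Measurable X) (hS : S.PosDef)
    {ν : EuclideanSpace ℝ (Fin n)} (hμ : ∀ j, ∑ i, ν.ofLp i * μ i j = 0)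
    (t : EuclideanSpace ℝ (Fin p)) :
    charFun (P.map fun ω => whitened S ν (X ω)) t =
      Complex.exp (-(‖ν‖ ^ 2 * ‖t‖ ^ 2) / 2) := by
  have := h.2.isProbabilityMeasure
  set R := toEuclideanCLM (n := Fin p) (𝕜 := ℝ) (CFC.sqrt S)⁻¹
  set Z : Fin n → EuclideanSpace ℝ (Fin p) → EuclideanSpace ℝ (Fin p) :=
    fun i y => R (y - WithLp.toLp 2 (μ i)) with hZ
  have hZm : ∀ i, Measurable (Z i) := fun i => by fun_prop
  have hZlaw : ∀ i, P.map (fun ω => Z i (WithLp.toLp 2 (X ω i))) =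
      stdGaussian (EuclideanSpace ℝ (Fin p)) := by
    intro i
    change P.map (Z i ∘ fun ω => WithLp.toLp 2 (X ω i)) = _
    -- A row is `μ i + S^{1/2} z` with `z` standard Gaussian, and `Z i` inverts this map.
    rw [← Measure.map_map (hZm i) (measurable_row hX i), h.1 i, multivariateGaussian,
      Measure.map_map (hZm i) (by fun_prop)]
    convert! Measure.map_id
    ext1 z
    simp only [hZ, Function.comp_apply, add_sub_cancel_left, id]
    rw [← mul_apply_eq_comp, ← map_mul, nonsing_inv_mul _ (isUnit_det_sqrt hS),
      map_one, one_apply_eq_self]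
  have hW : ∀ ω, whitened S ν (X ω) = ∑ i, ν.ofLp i • Z i (WithLp.toLp 2 (X ω i)) := by
    intro ω
    -- Centring the rows changes nothing, because `∑ ν_i μ_i = 0` under the null.
    have h0 : ∑ i, ν.ofLp i • (WithLp.toLp 2 (X ω i) - WithLp.toLp 2 (μ i)) =
        WithLp.toLp 2 ((X ω)ᵀ *ᵥ ν.ofLp) := by
      ext j
      simp [mulVec, dotProduct, mul_sub, Finset.sum_sub_distrib, hμ, mul_comm (X ω _ _)]
    simp only [hZ, ← map_smul, ← map_sum]
    rw [h0]
    rfl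
  have hind : iIndepFun (fun i ω => ν.ofLp i • Z i (WithLp.toLp 2 (X ω i))) P :=
    h.2.comp (fun i y => ν.ofLp i • Z i y) fun i => (hZm i).const_smul (ν.ofLp i)
  have hm : ∀ i, Measurable fun ω => Z i (WithLp.toLp 2 (X ω i)) := fun i =>
    (hZm i).comp (measurable_row hX i)
  have hmν : ∀ i, Measurable fun ω => ν.ofLp i • Z i (WithLp.toLp 2 (X ω i)) := fun i =>
    (hm i).const_smul (ν.ofLp i)
  simp_rw [hW]
  rw [iIndepFun.charFun_map_fun_sum_eq_prod (fun i => (hmν i).aemeasurable) hind,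
    Finset.prod_apply]
  have hi : ∀ i, charFun (P.map fun ω => ν.ofLp i • Z i (WithLp.toLp 2 (X ω i))) t =
      Complex.exp (((-(ν.ofLp i ^ 2 * ‖t‖ ^ 2) / 2 : ℝ)) : ℂ) := by
    intro i
    have hc : (fun ω => ν.ofLp i • Z i (WithLp.toLp 2 (X ω i))) =
        (fun z => ν.ofLp i • z) ∘ fun ω => Z i (WithLp.toLp 2 (X ω i)) := rfl
    rw [hc, ← Measure.map_map (by fun_prop) (hm i), hZlaw, charFun_map_smul, charFun_stdGaussian,
      norm_smul, ← Complex.ofReal_pow, mul_pow, Real.norm_eq_abs, sq_abs]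
    push_cast
    rfl
  rw [Finset.prod_congr rfl fun i _ => hi i, ← Complex.exp_sum, ← Complex.ofReal_sum,
    ← Finset.sum_div, Finset.sum_neg_distrib, ← Finset.sum_mul, ← EuclideanSpace.real_norm_sq_eq]
  push_cast
  rfl

/-- Under equal cluster means the test statistic has the scaled chi distribution and is
independent of the auxiliary statistics. -/
lemma exists_map_auxStat_statU (h : HasMatrixNormalLaw P X μ S) (hX : Measurable X)
    (hS : S.PosDef) (hp : 0 < p) {ν : EuclideanSpace ℝ (Fin n)} (hν : ν ≠ 0)
    (hμ : ∀ j, ∑ i, ν.ofLp i * μ i j = 0) :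
    ∃ (α : Measure (EuclideanSpace ℝ (Fin p) × Matrix (Fin n) (Fin p) ℝ)) (K : ℝ),
      IsFiniteMeasure α ∧ 0 < K ∧
      P.map (fun ω => (auxStat S ν (X ω), statU S ν (X ω))) =
        α.prod (volume.withDensity fun u => ENNReal.ofReal (K * scaledChiDensity ‖ν‖ p u)) := by
  have := h.2.isProbabilityMeasure
  have : Nonempty (Fin p) := ⟨⟨0, hp⟩⟩
  have hc : 0 < ‖ν‖ := norm_pos_iff.2 hν
  have hWm : Measurable fun ω => whitened S ν (X ω) := (measurable_whitened S ν).comp hX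
  have hPW : IsProbabilityMeasure (P.map fun ω => whitened S ν (X ω)) :=
    Measure.isProbabilityMeasure_map hWm.aemeasurable
  obtain ⟨K, hK, hlaw⟩ := exists_eq_withDensity_of_charFun hc (h.charFun_map_whitened hX hS hμ)
  obtain ⟨L, hL, hdens⟩ := exists_withDensity_eq_scaledChiDensity hp hc hK
  set ρ := (volume : Measure ℝ).withDensity fun u =>
    ENNReal.ofReal (L * scaledChiDensity ‖ν‖ p u) with hρ
  set σ := (volume : Measure (EuclideanSpace ℝ (Fin p))).toSphere.map Subtype.val
  have hpolar : P.map (fun ω => (dir (whitened S ν (X ω)), ‖whitened S ν (X ω)‖)) =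
      σ.prod ρ := by
    have hc : (fun ω => (dir (whitened S ν (X ω)), ‖whitened S ν (X ω)‖)) =
      (fun x => (‖x‖⁻¹ • x, ‖x‖)) ∘ fun ω => whitened S ν (X ω) := rfl
    rw [hc, ← Measure.map_map (by fun_prop) hWm, hlaw, map_dir_norm_withDensity
      (g := fun r => ENNReal.ofReal (K * Real.exp (-(r / ‖ν‖) ^ 2 / 2))) (by fun_prop),
      finrank_euclideanSpace_fin, hdens]
  set π : Ω → Matrix (Fin n) (Fin p) ℝ := fun ω => (auxStat S ν (X ω)).2
  have hπm : Measurable π := ((measurable_auxStat S ν).comp hX).snd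
  have hind : IndepFun (fun ω => (dir (whitened S ν (X ω)), ‖whitened S ν (X ω)‖)) π P := by
    have h0 := h.indepFun_sum_residual hX hS.posSemidef hν
    have hφ : Measurable fun v : Fin p → ℝ => WithLp.toLp 2 ((CFC.sqrt S)⁻¹ *ᵥ v) := by
      refine (WithLp.measurable_toLp 2 _).comp (measurable_pi_lambda _ fun k => ?_)
      simp only [mulVec, dotProduct]
      fun_prop
    have hψ : Measurable fun (f : Fin n × Fin p → ℝ) => (Matrix.of fun i j => f (i, j)) :=
      measurable_matrix fun i j => measurable_pi_apply (i, j)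
    have h1 := h0.comp ((measurable_dir.comp hφ).prodMk hφ.norm) hψ
    convert! h1 using 1
    · ext1 ω
      have : whitened S ν (X ω) =
          WithLp.toLp 2 ((CFC.sqrt S)⁻¹ *ᵥ fun j => ∑ i, ν.ofLp i * X ω i j) := by
        rw [whitened]
        congr 3
        ext j
        simp [mulVec, dotProduct, mul_comm]
      simp only [Function.comp_apply, this]
    · ext ω i j
      exact auxStat_snd_apply _ _ _
  have hTm : Measurable fun ω => (dir (whitened S ν (X ω)), ‖whitened S ν (X ω)‖) :=
    (measurable_dir.comp hWm).prodMk hWm.norm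
  have hjoint := (indepFun_iff_map_prod_eq_prod_map_map
    hTm.aemeasurable hπm.aemeasurable).1 hind
  rw [hpolar] at hjoint
  have : IsFiniteMeasure σ := Measure.isFiniteMeasure_map _ _
  have : SFinite ρ := by rw [hρ]; infer_instance
  -- `σ` is unnormalized surface measure, so `α` need not be a probability measure.
  refine ⟨σ.prod (P.map π), L, inferInstance, hL, ?_⟩
  rw [← map_prod_prod_right_comm, ← hjoint, Measure.map_map (by fun_prop) (hTm.prodMk hπm)]
  rfl

end HasMatrixNormalLaw

end Gaussian

/-! ### Conditional law from a joint density -/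

section Density

variable {β : Type*} [MeasurableSpace β]

lemma map_withDensity_comp {γ : Type*} [MeasurableSpace γ] (ρ : Measure β) {f : β → γ}
    (hf : Measurable f) {g : γ → ENNReal} (hg : Measurable g) :
    (ρ.withDensity (g ∘ f)).map f = (ρ.map f).withDensity g := by
  ext s hs
  rw [Measure.map_apply hf hs, withDensity_apply _ (hf hs), withDensity_apply _ hs,
    setLIntegral_map hs hg hf]
  rfl

/-- The kernel with the normalized density `w a / ∫ w a`. -/
noncomputable def normalizedKernel (w : β → ℝ → ENNReal) : Kernel β ℝ :=
  Kernel.withDensity (Kernel.const β volume) fun a u => (∫⁻ v, w a v)⁻¹ * w a u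

variable {w : β → ℝ → ENNReal}

lemma measurable_uncurry_normalized (hw : Measurable (Function.uncurry w)) :
    Measurable (Function.uncurry fun a u => (∫⁻ v, w a v)⁻¹ * w a u) := by
  have hZ : Measurable fun a => ∫⁻ v, w a v := hw.lintegral_prod_right'
  exact (hZ.comp measurable_fst).inv.mul hw

lemma normalizedKernel_apply (hw : Measurable (Function.uncurry w)) (a : β) {s : Set ℝ} :
    normalizedKernel w a s = (∫⁻ v, w a v)⁻¹ * ∫⁻ u in s, w a u := by
  rw [normalizedKernel, Kernel.withDensity_apply' _ (measurable_uncurry_normalized hw),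
    Kernel.const_apply, lintegral_const_mul _ hw.of_uncurry_left]

lemma isMarkovKernel_normalizedKernel (hw : Measurable (Function.uncurry w))
    (h0 : ∀ a, ∫⁻ v, w a v ≠ 0) (h1 : ∀ a, ∫⁻ v, w a v ≠ ⊤) :
    IsMarkovKernel (normalizedKernel w) := by
  refine ⟨fun a => ⟨?_⟩⟩
  rw [normalizedKernel_apply hw, Measure.restrict_univ, ENNReal.inv_mul_cancel (h0 a) (h1 a)]

/-- A joint density determines the conditional distribution. -/
lemma condDistrib_ae_eq_normalizedKernel (hw : Measurable (Function.uncurry w))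
    (h0 : ∀ a, ∫⁻ v, w a v ≠ 0) (h1 : ∀ a, ∫⁻ v, w a v ≠ ⊤)
    {Ω : Type*} [MeasurableSpace Ω] {Q : Measure Ω}
    [IsFiniteMeasure Q] {A : Ω → β} {U : Ω → ℝ} (hA : Measurable A) (hU : Measurable U)
    {α : Measure β} [SFinite α]
    (hQ : Q.map (fun ω => (A ω, U ω)) =
      (α.prod volume).withDensity fun z => w z.1 z.2) :
    condDistrib U A Q =ᵐ[Q.map A] normalizedKernel w := by
  have := isMarkovKernel_normalizedKernel hw h0 h1
  have hw' : Measurable fun z : β × ℝ => w z.1 z.2 := hw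
  have hZ : Measurable fun a => ∫⁻ v, w a v := hw'.lintegral_prod_right'
  refine condDistrib_ae_eq_of_measure_eq_compProd A hU.aemeasurable ?_
  -- The marginal density of `A` is the normalizer `∫ w a`, which cancels the inverse in the kernel.
  have hQA : Q.map A = α.withDensity fun a => ∫⁻ v, w a v := by
    have : Q.map A = (Q.map fun ω => (A ω, U ω)).map Prod.fst := by
      rw [Measure.map_map measurable_fst (hA.prodMk hU)]
      rfl
    rw [this, hQ]
    refine Measure.ext_of_lintegral _ fun f hf => ?_
    have hff : Measurable fun z : β × ℝ => f z.1 := hf.comp measurable_fst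
    rw [lintegral_map hf measurable_fst, lintegral_withDensity_eq_lintegral_mul _ hw' hff,
      lintegral_withDensity_eq_lintegral_mul _ hZ hf, lintegral_prod _ (hw'.mul hff).aemeasurable]
    refine lintegral_congr fun a => ?_
    simp only [Pi.mul_apply]
    rw [lintegral_mul_const _ hw.of_uncurry_left]
  refine Measure.ext_of_lintegral _ fun F hF => ?_
  have hFa : ∀ a, Measurable fun u => F (a, u) := fun a => hF.comp (by fun_prop)
  rw [Measure.lintegral_compProd hF, hQ, hQA,
    lintegral_withDensity_eq_lintegral_mul _ hw' hF, lintegral_prod _ (hw'.mul hF).aemeasurable,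
    lintegral_withDensity_eq_lintegral_mul _ hZ hF.lintegral_kernel_prod_right']
  refine lintegral_congr fun a => ?_
  simp only [Pi.mul_apply]
  rw [normalizedKernel, Kernel.lintegral_withDensity _ (measurable_uncurry_normalized hw) _ (hFa a),
    Kernel.const_apply]
  simp_rw [mul_assoc]
  have hwF : Measurable fun u => w a u * F (a, u) := hw.of_uncurry_left.mul (hFa a)
  rw [lintegral_const_mul _ hwF, ← mul_assoc,
    ENNReal.mul_inv_cancel (h0 a) (h1 a), one_mul]

end Density

/-! ### Integrability and positivity of the selective weight -/

section SelectiveWeight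

variable {d : Linkage n p} {τ : ℝ} {S : Matrix (Fin p) (Fin p) ℝ}
  {ν : EuclideanSpace ℝ (Fin n)} {m : ℕ → Merge n} {t : ℕ}
  {a : EuclideanSpace ℝ (Fin p) × Matrix (Fin n) (Fin p) ℝ} {u c : ℝ}

lemma scaledChiDensity_pos (hp : 0 < p) (hc : 0 < c) (hu : 0 < u) :
    0 < scaledChiDensity c p u := by
  have hu' : 0 < u / c := div_pos hu hc
  have := Real.Gamma_pos_of_pos (show (0 : ℝ) < p / 2 by positivity)
  rw [scaledChiDensity, chiDensity, if_pos hu']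
  positivity

lemma scaledChiDensity_of_nonpos (hc : 0 < c) (hu : u ≤ 0) : scaledChiDensity c p u = 0 := by
  rw [scaledChiDensity, chiDensity, if_neg (not_lt.2 (div_nonpos_of_nonpos_of_nonneg hu hc.le)),
    mul_zero]

lemma scaledChiDensity_nonneg (hp : 0 < p) (hc : 0 < c) : 0 ≤ scaledChiDensity c p u := by
  rcases lt_or_ge 0 u with hu | hu
  · exact (scaledChiDensity_pos hp hc hu).le
  · exact (scaledChiDensity_of_nonpos hc hu).ge

lemma measurable_scaledChiDensity : Measurable (scaledChiDensity c p) := by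
  have : Measurable (chiDensity p) := by
    unfold chiDensity
    exact Measurable.ite measurableSet_Ioi (by fun_prop) measurable_const
  unfold scaledChiDensity
  fun_prop

lemma integrable_chiDensity : Integrable (chiDensity p) := by
  have h := (integrableOn_rpow_mul_exp_neg_mul_sq (b := 1 / 2) (by norm_num)
    (s := ((p - 1 : ℕ) : ℝ)) (by linarith [Nat.cast_nonneg (α := ℝ) (p - 1)])).div_const
      (2 ^ ((p : ℝ) / 2 - 1) * Real.Gamma ((p : ℝ) / 2))
  refine ((integrable_indicator_iff measurableSet_Ioi).2 h).congr (ae_of_all _ fun u => ?_)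
  by_cases hu : 0 < u
  · rw [indicator_of_mem (mem_Ioi.2 hu), chiDensity, if_pos hu, Real.rpow_natCast]
    congr 3
    ring
  · rw [indicator_of_notMem (by simpa using hu), chiDensity, if_neg hu]

lemma integrable_scaledChiDensity (hc : 0 < c) : Integrable (scaledChiDensity c p) :=
  (integrable_chiDensity.comp_div hc.ne').const_mul _

lemma selectiveWeight_of_nonpos (hν : ν ≠ 0) (hu : u ≤ 0) :
    selectiveWeight d τ S ν m t a u = 0 := by
  rw [selectiveWeight, scaledChiDensity_of_nonpos (norm_pos_iff.2 hν) hu, zero_mul]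

lemma selectiveWeight_nonneg (hp : 0 < p) (hν : ν ≠ 0) : 0 ≤ selectiveWeight d τ S ν m t a u :=
  mul_nonneg (scaledChiDensity_nonneg hp (norm_pos_iff.2 hν))
    (Finset.prod_nonneg fun _ _ => mergeProb_nonneg)

lemma selectiveWeight_pos (hp : 0 < p) (hν : ν ≠ 0)
    (hm : ∀ s ≤ t, m s ∈ candidates (clusters m s)) (hu : 0 < u) :
    0 < selectiveWeight d τ S ν m t a u :=
  mul_pos (scaledChiDensity_pos hp (norm_pos_iff.2 hν) hu)
    (Finset.prod_pos fun s hs => mergeProb_pos (hm s (by simpa [Nat.lt_succ_iff] using hs)))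

lemma measurable_selectiveWeight (hd : ∀ M, Measurable (d M)) :
    Measurable (Function.uncurry (selectiveWeight d τ S ν m t)) :=
  (measurable_scaledChiDensity.comp measurable_snd).mul
    (Finset.measurable_prod _ fun _ _ =>
      (measurable_mergeProb hd).comp (measurable_reconstruct S ν))

/-- The merge probabilities are at most `1`, so the chi density dominates. -/
lemma integrable_selectiveWeight (hd : ∀ M, Measurable (d M)) (hp : 0 < p) (hν : ν ≠ 0) :
    Integrable (selectiveWeight d τ S ν m t a) := by
  refine (integrable_scaledChiDensity (p := p) (norm_pos_iff.2 hν)).mono'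
    (measurable_selectiveWeight hd).of_uncurry_left.aestronglyMeasurable (ae_of_all _ fun u => ?_)
  rw [Real.norm_of_nonneg (selectiveWeight_nonneg hp hν), selectiveWeight]
  exact mul_le_of_le_one_right (scaledChiDensity_nonneg hp (norm_pos_iff.2 hν))
    (Finset.prod_le_one (fun _ _ => mergeProb_nonneg) fun _ _ => mergeProb_le_one)

lemma integral_selectiveWeight_pos (hd : ∀ M, Measurable (d M)) (hp : 0 < p) (hν : ν ≠ 0)
    (hm : ∀ s ≤ t, m s ∈ candidates (clusters m s)) :
    0 < ∫ u in Ioi 0, selectiveWeight d τ S ν m t a u := by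
  rw [setIntegral_pos_iff_support_of_nonneg_ae
    (ae_of_all _ fun u => selectiveWeight_nonneg hp hν)
    (integrable_selectiveWeight hd hp hν).integrableOn]
  have : Ioi 0 ⊆ Function.support (selectiveWeight d τ S ν m t a) := fun u hu =>
    (selectiveWeight_pos hp hν hm hu).ne'
  rw [inter_eq_self_of_subset_right this, Real.volume_Ioi]
  exact ENNReal.zero_lt_top

lemma integral_selectiveWeight (hν : ν ≠ 0) :
    ∫ u, selectiveWeight d τ S ν m t a u = ∫ u in Ioi 0, selectiveWeight d τ S ν m t a u :=
  (setIntegral_eq_integral_of_forall_compl_eq_zero fun _ hu =>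
    selectiveWeight_of_nonpos hν (not_lt.1 hu)).symm

/-- The weight vanishes on `(-∞, 0]`. For `u < 0` the interval `Ioc 0 u` is empty, which gives the
zero branch of the distribution function. -/
lemma setIntegral_Iic_selectiveWeight (hν : ν ≠ 0) (u : ℝ) :
    ∫ v in Iic u, selectiveWeight d τ S ν m t a v =
      ∫ v in Ioc 0 u, selectiveWeight d τ S ν m t a v := by
  refine setIntegral_eq_of_subset_of_forall_sdiff_eq_zero measurableSet_Iic
    (fun v hv => hv.2) fun v hv => selectiveWeight_of_nonpos hν ?_
  exact not_lt.1 fun h => hv.2 ⟨h, hv.1⟩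

end SelectiveWeight

end RandClust

/-! ### The selective distribution of the test statistic -/

/-- Merges are indexed from `0`, so `m 0, …, m t` are the first `t + 1` observed merges, and the
pair of clusters under test is the last one, `m t = {C₁, C₂}`. -/
theorem mainTheorem4 {Ω : Type*} [MeasurableSpace Ω] (P : Measure Ω) [IsProbabilityMeasure P]
    {n p : ℕ} (hp : 0 < p)
    (S : Matrix (Fin p) (Fin p) ℝ) (hS : S.PosDef)
    (μ : Matrix (Fin n) (Fin p) ℝ)
    (d : RandClust.Linkage n p) (hd : ∀ M, Measurable (d M))
    (τ : ℝ) (hτ : 0 < τ)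
    (X : Ω → Matrix (Fin n) (Fin p) ℝ) (hX : Measurable X)
    (hXlaw : RandClust.HasMatrixNormalLaw P X μ S)
    (M : ℕ → Ω → RandClust.Merge n) (t : ℕ)
    (hM : RandClust.IsRandomizedClustering P d τ X M (t + 1))
    (m : ℕ → RandClust.Merge n)
    (hm : ∀ s ≤ t, m s ∈ RandClust.candidates (RandClust.clusters m s))
    (C₁ C₂ : RandClust.Cluster n) (hC : m t = {C₁, C₂})
    (hnull : RandClust.clusterMean μ C₁ = RandClust.clusterMean μ C₂) :
    let ν := RandClust.contrast C₁ C₂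
    let E : Set Ω := {ω | ∀ s ≤ t, M s ω = m s}
    let U : Ω → ℝ := fun ω => RandClust.statU S ν (X ω)
    let A := fun ω => RandClust.auxStat S ν (X ω)
    let w := RandClust.selectiveWeight d τ S ν m t
    P E ≠ 0 ∧
      ∀ᵐ a ∂((P[|E]).map A),
        IntegrableOn (w a) (Ioi 0) ∧ 0 < (∫ u' in Ioi 0, w a u') ∧
          ∀ u : ℝ, cdf (condDistrib U A (P[|E]) a) u =
            (∫ u' in Ioc 0 u, w a u') / (∫ u' in Ioi 0, w a u') := by
  intro ν E U A w
  obtain ⟨hne, hdisj⟩ := RandClust.clusters_nonempty_disjoint (s := t) fun r hr => hm r hr.le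
  have hmt := hm t le_rfl
  rw [RandClust.candidates, Finset.mem_powersetCard, hC] at hmt
  have hC₁ : C₁ ∈ RandClust.clusters m t := hmt.1 (by simp)
  have hC₂ : C₂ ∈ RandClust.clusters m t := hmt.1 (by simp)
  have hCne : C₁ ≠ C₂ := by
    rintro rfl
    simp at hmt
  have hν : ν ≠ 0 := RandClust.contrast_ne_zero (hne _ hC₁) (hdisj _ hC₁ _ hC₂ hCne)
  set G : Matrix (Fin n) (Fin p) ℝ → ENNReal := fun x => ENNReal.ofReal
    (∏ s ∈ Finset.range (t + 1), RandClust.mergeProb d τ (RandClust.clusters m s) (m s) x)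
  have hGm : Measurable G :=
    (Finset.measurable_prod _ fun _ _ => RandClust.measurable_mergeProb hd).ennreal_ofReal
  have hGpos : ∀ x, 0 < G x := fun x => ENNReal.ofReal_pos.2
    (Finset.prod_pos fun s hs =>
      RandClust.mergeProb_pos (hm s (by simpa [Nat.lt_succ_iff] using hs)))
  have hE : E = {ω | ∀ r < t + 1, M r ω = m r} := by
    ext ω
    simp [E]
  have hlaw : (P.restrict E).map X = (P.map X).withDensity G := by
    rw [hE]
    exact RandClust.map_restrict_merges hd hX hM m le_rfl
  have hPX : IsProbabilityMeasure (P.map X) := Measure.isProbabilityMeasure_map hX.aemeasurable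
  have hPE : P E ≠ 0 := by
    intro h0
    have : (P.map X).withDensity G = 0 := by
      rw [← hlaw, Measure.restrict_eq_zero.2 h0, Measure.map_zero]
    -- If `E` were null, `G` would vanish almost surely under the law of `X`, though it is positive
    -- everywhere.
    rw [withDensity_eq_zero_iff hGm.aemeasurable] at this
    obtain ⟨x, hx⟩ := this.exists
    exact (hGpos x).ne' hx
  refine ⟨hPE, ?_⟩
  have hAm : Measurable A := (RandClust.measurable_auxStat S ν).comp hX
  have hUm : Measurable U := (RandClust.measurable_statU S ν).comp hX
  obtain ⟨α, K, hα, hK, hjoint⟩ := hXlaw.exists_map_auxStat_statU hX hS hp hν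
    (RandClust.sum_contrast_mul hnull)
  set Φ : Matrix (Fin n) (Fin p) ℝ → (EuclideanSpace ℝ (Fin p) × Matrix (Fin n) (Fin p) ℝ) × ℝ :=
    fun x => (RandClust.auxStat S ν x, RandClust.statU S ν x)
  have hΦm : Measurable Φ :=
    (RandClust.measurable_auxStat S ν).prodMk (RandClust.measurable_statU S ν)
  set R : (EuclideanSpace ℝ (Fin p) × Matrix (Fin n) (Fin p) ℝ) × ℝ → ENNReal :=
    fun z => G (RandClust.reconstruct S ν z.1 z.2)
  have hRm : Measurable R := hGm.comp (RandClust.measurable_reconstruct S ν)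
  have hRΦ : R ∘ Φ = G := funext fun x => congrArg G (RandClust.reconstruct_auxStat hS x)
  have hwm : Measurable (Function.uncurry fun a u => ENNReal.ofReal (w a u)) :=
    (RandClust.measurable_selectiveWeight hd).ennreal_ofReal
  have hwi : ∀ a, Integrable (w a) := fun a => RandClust.integrable_selectiveWeight hd hp hν
  have hw0 : ∀ a u, 0 ≤ w a u := fun a u => RandClust.selectiveWeight_nonneg hp hν
  have hwpos : ∀ a, 0 < ∫ u in Ioi 0, w a u := fun a =>
    RandClust.integral_selectiveWeight_pos hd hp hν hm
  have hZ : ∀ a, ∫⁻ u, ENNReal.ofReal (w a u) = ENNReal.ofReal (∫ u in Ioi 0, w a u) := by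
    intro a
    rw [← RandClust.integral_selectiveWeight hν]
    exact (ofReal_integral_eq_lintegral_ofReal (hwi a) (ae_of_all _ (hw0 a))).symm
  have hsc : Measurable fun u => ENNReal.ofReal (K * RandClust.scaledChiDensity ‖ν‖ p u) :=
    (RandClust.measurable_scaledChiDensity.const_mul K).ennreal_ofReal
  have hsc' : Measurable fun z : (EuclideanSpace ℝ (Fin p) × Matrix (Fin n) (Fin p) ℝ) × ℝ =>
      ENNReal.ofReal (K * RandClust.scaledChiDensity ‖ν‖ p z.2) := hsc.comp measurable_snd
  have hwm' : Measurable fun z : (EuclideanSpace ℝ (Fin p) × Matrix (Fin n) (Fin p) ℝ) × ℝ =>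
      ENNReal.ofReal (w z.1 z.2) := hwm
  -- The constants `(P E)⁻¹` and `K` are absorbed into `α`, leaving `w` itself as the density.
  have hQ : (P[|E]).map (fun ω => (A ω, U ω)) =
      ((((P E)⁻¹ * ENNReal.ofReal K) • α).prod volume).withDensity
        fun z => ENNReal.ofReal (w z.1 z.2) := by
    have h1 : (P.restrict E).map (fun ω => (A ω, U ω)) =
        ENNReal.ofReal K • (α.prod volume).withDensity fun z => ENNReal.ofReal (w z.1 z.2) := by
      calc (P.restrict E).map (fun ω => (A ω, U ω))
          = ((P.restrict E).map X).map Φ := (Measure.map_map hΦm hX).symm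
        _ = ((P.map X).map Φ).withDensity R := by
            rw [hlaw, ← hRΦ, RandClust.map_withDensity_comp _ hΦm hRm]
        _ = ((α.prod volume).withDensity fun z =>
              ENNReal.ofReal (K * RandClust.scaledChiDensity ‖ν‖ p z.2)).withDensity R := by
            rw [Measure.map_map hΦm hX, ← prod_withDensity_right hsc, ← hjoint]
            rfl
        _ = _ := by
            rw [← withDensity_mul _ hsc' hRm,
              ← withDensity_smul _ hwm']
            congr 1
            ext1 z
            simp only [Pi.mul_apply, Pi.smul_apply, smul_eq_mul, R, G]
            rw [← ENNReal.ofReal_mul hK.le, ← ENNReal.ofReal_mul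
              (mul_nonneg hK.le (RandClust.scaledChiDensity_nonneg hp (norm_pos_iff.2 hν))),
              mul_assoc]
            rfl
    rw [ProbabilityTheory.cond, Measure.map_smul, h1, smul_smul, Measure.prod_smul_left,
      withDensity_smul_measure]
  have hprob : IsProbabilityMeasure (P[|E]) := cond_isProbabilityMeasure hPE
  have hcond := RandClust.condDistrib_ae_eq_normalizedKernel hwm
    (fun a => by rw [hZ]; exact (ENNReal.ofReal_pos.2 (hwpos a)).ne')
    (fun a => by rw [hZ]; exact ENNReal.ofReal_ne_top) hAm hUm hQ
  filter_upwards [hcond] with a ha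
  refine ⟨(hwi a).integrableOn, hwpos a, fun u => ?_⟩
  rw [cdf_eq_real, ha, measureReal_def, RandClust.normalizedKernel_apply hwm, hZ,
    ← ofReal_integral_eq_lintegral_ofReal (hwi a).integrableOn (ae_of_all _ (hw0 a)),
    RandClust.setIntegral_Iic_selectiveWeight hν, ENNReal.toReal_mul, ENNReal.toReal_inv,
    ENNReal.toReal_ofReal (hwpos a).le,
    ENNReal.toReal_ofReal (integral_nonneg (hw0 a)), inv_mul_eq_div]
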